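/- Let $\Omega\subseteq\mathbb{R}^N$ be an open set, bounded or not, with the segment property: every $x\in\partial\Omega$ has a neighbourhood $U$ and a vector $y\neq 0$ such that $z+ty\in\Omega$ for all $z\in\overline{\Omega}\cap U$ and $0<t<1$. Let $A$ be an $N$-function, that is, $A(t)=\int_0^t a(s)\,ds$ for $t\ge 0$, where $a:[0,\infty)\to\mathbb{R}$ is nondecreasing and right-continuous, $a(0)=0$, $a(s)>0$ for $s>0$ and $a(s)\to\infty$ as $s\to\infty$; let $\overline{A}(s)=\sup_{t\ge0}\{st-A(t)\}$ be its complementary function. Let $L_A(\Omega)$ be the Orlicz space of (classes of) measurable functions $u:\Omega\to\mathbb{R}$ such that $\int_\Omega A(|u|/\lambda)\,dx<\infty$ for some $\lambda>0$, with the Luxemburg norm $\|u\|_A=\inf\{\lambda>0:\int_\Omega A(|u|/\lambda)\,dx\le1\}$; let $E_{\overline{A}}(\Omega)$ be the norm closure in $L_{\overline{A}}(\Omega)$ of the bounded measurable functions with compact support in $\overline{\Omega}$; let $W^1L_A(\Omega)$ be the space of $u\in L_A(\Omega)$ whose weak derivatives $\partial_1u,\dots,\partial_Nu$ all belong to $L_A(\Omega)$;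 and let $W^1_0L_A(\Omega)$ be the closure of $C_0^\infty(\Omega)$ in $W^1L_A(\Omega)$ with respect to the weak* topology $\sigma(\Pi L_A,\Pi E_{\overline{A}})$, that is, the coarsest topology for which all the functionals $u\mapsto\int_\Omega u\,v_0\,dx+\sum_{i=1}^N\int_\Omega \partial_iu\,v_i\,dx$ with $v_0,\dots,v_N\in E_{\overline{A}}(\Omega)$ are continuous. If $u\in W^1L_A(\Omega)$ and the (essential) support of $u$ is a compact subset of $\Omega$, then $u\in W^1_0L_A(\Omega)$. -/

import Mathlib

open MeasureTheory Set Filter Topology TopologicalSpace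
open scoped ENNReal Distributions

noncomputable section

namespace OrliczSobolev

/-- `A` restricted to `[0,∞)` is an N-function: `A t = ∫₀ᵗ a(s) ds` for a nondecreasing,
right-continuous `a : [0,∞) → ℝ` with `a 0 = 0`, `a > 0` on `(0,∞)` and `a(t) → ∞` as `t → ∞`.
The values of `A` at negative numbers are never used. -/
def IsNFunction (A : ℝ → ℝ) : Prop :=
  ∃ a : ℝ → ℝ, a 0 = 0 ∧ (∀ t, 0 < t → 0 < a t) ∧ MonotoneOn a (Ici 0) ∧
    (∀ t, 0 ≤ t → ContinuousWithinAt a (Ici t) t) ∧ Tendsto a atTop atTop ∧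
    ∀ t, 0 ≤ t → A t = ∫ s in (0 : ℝ)..t, a s

/-- The complementary function `s ↦ sup_{t ≥ 0} (s t - A t)` (used for `s ≥ 0` only). -/
def complementary (A : ℝ → ℝ) (s : ℝ) : ℝ :=
  sSup ((fun t : ℝ => s * t - A t) '' Ici 0)

/-- The segment property of a subset of `ℝ^N`. -/
def SegmentProperty {N : ℕ} (Ω : Set (EuclideanSpace ℝ (Fin N))) : Prop :=
  ∀ x ∈ frontier Ω, ∃ U ∈ 𝓝 x, ∃ y : EuclideanSpace ℝ (Fin N), y ≠ 0 ∧
    ∀ z ∈ closure Ω ∩ U, ∀ t : ℝ, 0 < t → t < 1 → z + t • y ∈ Ω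

/-- Classes, up to equality almost everywhere, of measurable real functions on `Ω`. -/
abbrev MeasFun {N : ℕ} (Ω : Opens (EuclideanSpace ℝ (Fin N))) : Type :=
  EuclideanSpace ℝ (Fin N) →ₘ[volume.restrict (Ω : Set (EuclideanSpace ℝ (Fin N)))] ℝ

variable {N : ℕ}

/-- The modular `∫_Ω A(|u| / c) dx`, with values in `[0,∞]`. -/
def modular (A : ℝ → ℝ) (Ω : Opens (EuclideanSpace ℝ (Fin N))) (u : MeasFun Ω) (c : ℝ) : ℝ≥0∞ :=
  ∫⁻ x in (Ω : Set (EuclideanSpace ℝ (Fin N))), ENNReal.ofReal (A (|u x| / c))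

/-- The Orlicz space `L_A(Ω)`. -/
def OrliczSpace (A : ℝ → ℝ) (Ω : Opens (EuclideanSpace ℝ (Fin N))) : Set (MeasFun Ω) :=
  {u | ∃ c : ℝ, 0 < c ∧ modular A Ω u c < ⊤}

/-- The Luxemburg norm `inf {c > 0 : ∫_Ω A(|u| / c) dx ≤ 1}`, equal to `⊤` if there is no such
`c`. -/
def luxemburgNorm (A : ℝ → ℝ) (Ω : Opens (EuclideanSpace ℝ (Fin N))) (u : MeasFun Ω) : ℝ≥0∞ :=
  ⨅ (c : ℝ) (_ : 0 < c ∧ modular A Ω u c ≤ 1), ENNReal.ofReal c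

/-- The support of (a class of) a function `u` on `Ω`: the points of `ℝ^N` that have no
neighbourhood `U` such that `u = 0` almost everywhere in `Ω ∩ U`. It is a closed subset
of the closure of `Ω`. -/
def essSupport (Ω : Opens (EuclideanSpace ℝ (Fin N))) (u : MeasFun Ω) :
    Set (EuclideanSpace ℝ (Fin N)) :=
  {x | ∀ U ∈ 𝓝 x,
    ¬ ∀ᵐ y ∂(volume.restrict (Ω : Set (EuclideanSpace ℝ (Fin N)))), y ∈ U → u y = 0}

/-- (Classes of) bounded measurable functions on `Ω` with compact support in the closure
of `Ω`. -/
def boundedCompactSupport (Ω : Opens (EuclideanSpace ℝ (Fin N))) : Set (MeasFun Ω) :=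
  {w | (∃ C : ℝ, ∀ᵐ x ∂(volume.restrict (Ω : Set (EuclideanSpace ℝ (Fin N)))), |w x| ≤ C) ∧
    IsCompact (essSupport Ω w)}

/-- The space `E_A(Ω)`: the norm closure in `L_A(Ω)` of the bounded measurable functions with
compact support in the closure of `Ω`. -/
def EOrlicz (A : ℝ → ℝ) (Ω : Opens (EuclideanSpace ℝ (Fin N))) : Set (MeasFun Ω) :=
  {v | v ∈ OrliczSpace A Ω ∧ ∀ ε : ℝ≥0∞, 0 < ε →
    ∃ w ∈ boundedCompactSupport Ω, w ∈ OrliczSpace A Ω ∧ luxemburgNorm A Ω (v - w) < ε}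

/-- The classical partial derivative `∂φ/∂x_i`. -/
def partialDeriv (i : Fin N) (φ : EuclideanSpace ℝ (Fin N) → ℝ)
    (x : EuclideanSpace ℝ (Fin N)) : ℝ :=
  fderiv ℝ φ x (EuclideanSpace.single i 1)

/-- `g` is the weak (distributional) derivative `∂u/∂x_i` in `Ω`. -/
def HasWeakPartialDeriv (Ω : Opens (EuclideanSpace ℝ (Fin N))) (i : Fin N)
    (u g : MeasFun Ω) : Prop :=
  LocallyIntegrableOn u (Ω : Set (EuclideanSpace ℝ (Fin N))) volume ∧
  LocallyIntegrableOn g (Ω : Set (EuclideanSpace ℝ (Fin N))) volume ∧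
  ∀ φ : 𝓓(Ω, ℝ),
    ∫ x in (Ω : Set (EuclideanSpace ℝ (Fin N))), u x * partialDeriv i φ x =
      - ∫ x in (Ω : Set (EuclideanSpace ℝ (Fin N))), g x * φ x

/-- The Orlicz-Sobolev space `W^1 L_A(Ω)`. -/
def W1Orlicz (A : ℝ → ℝ) (Ω : Opens (EuclideanSpace ℝ (Fin N))) : Set (MeasFun Ω) :=
  {u | u ∈ OrliczSpace A Ω ∧ ∀ i : Fin N, ∃ g ∈ OrliczSpace A Ω, HasWeakPartialDeriv Ω i u g}

/-- The weak derivative `∂u/∂x_i` of `u ∈ W^1 L_A(Ω)` (it is unique as a class). -/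
def weakPartial {A : ℝ → ℝ} {Ω : Opens (EuclideanSpace ℝ (Fin N))} (u : W1Orlicz A Ω)
    (i : Fin N) : OrliczSpace A Ω :=
  ⟨(u.2.2 i).choose, (u.2.2 i).choose_spec.1⟩

/-- The product `Π L_A` of `N + 1` copies of `L_A(Ω)`. -/
abbrev ProdOrlicz (A : ℝ → ℝ) (Ω : Opens (EuclideanSpace ℝ (Fin N))) : Type :=
  OrliczSpace A Ω × (Fin N → OrliczSpace A Ω)

/-- The product `Π E_A` of `N + 1` copies of `E_A(Ω)`. -/
abbrev ProdEOrlicz (A : ℝ → ℝ) (Ω : Opens (EuclideanSpace ℝ (Fin N))) : Type :=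
  EOrlicz A Ω × (Fin N → EOrlicz A Ω)

/-- The duality pairing of `Π L_A` with `Π E_{Ā}`, where `Ā` is complementary to `A`. -/
def pairing {A : ℝ → ℝ} {Ω : Opens (EuclideanSpace ℝ (Fin N))}
    (v : ProdEOrlicz (complementary A) Ω) (u : ProdOrlicz A Ω) : ℝ :=
  (∫ x in (Ω : Set (EuclideanSpace ℝ (Fin N))), u.1.1 x * v.1.1 x) +
    ∑ i : Fin N, ∫ x in (Ω : Set (EuclideanSpace ℝ (Fin N))), (u.2 i).1 x * (v.2 i).1 x

/-- The weak* topology `σ(Π L_A, Π E_{Ā})`: the coarsest topology on `Π L_A` for which the pairing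
with every element of `Π E_{Ā}` is continuous. -/
def weakStar (A : ℝ → ℝ) (Ω : Opens (EuclideanSpace ℝ (Fin N))) :
    TopologicalSpace (ProdOrlicz A Ω) :=
  ⨅ v : ProdEOrlicz (complementary A) Ω,
    TopologicalSpace.induced (pairing v) (inferInstance : TopologicalSpace ℝ)

/-- The embedding `u ↦ (u, ∂u/∂x_1, …, ∂u/∂x_N)` of `W^1 L_A(Ω)` into `Π L_A`. -/
def jet {A : ℝ → ℝ} {Ω : Opens (EuclideanSpace ℝ (Fin N))} (u : W1Orlicz A Ω) :
    ProdOrlicz A Ω :=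
  (⟨u.1, u.2.1⟩, weakPartial u)

/-- The weak* topology `σ(Π L_A, Π E_{Ā})` on `W^1 L_A(Ω)`. -/
def weakStarW1 (A : ℝ → ℝ) (Ω : Opens (EuclideanSpace ℝ (Fin N))) :
    TopologicalSpace (W1Orlicz A Ω) :=
  TopologicalSpace.induced jet (weakStar A Ω)

/-- `C_0^∞(Ω)` as a subset of `W^1 L_A(Ω)`. -/
def testFunctions (A : ℝ → ℝ) (Ω : Opens (EuclideanSpace ℝ (Fin N))) : Set (W1Orlicz A Ω) :=
  {w | ∃ φ : 𝓓(Ω, ℝ), w.1 =ᵐ[volume.restrict (Ω : Set (EuclideanSpace ℝ (Fin N)))] φ}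

/-- The space `W^1_0 L_A(Ω)`: the closure of `C_0^∞(Ω)` in `W^1 L_A(Ω)` with respect to the weak*
topology `σ(Π L_A, Π E_{Ā})`. -/
def W10Orlicz (A : ℝ → ℝ) (Ω : Opens (EuclideanSpace ℝ (Fin N))) : Set (W1Orlicz A Ω) :=
  @closure (W1Orlicz A Ω) (weakStarW1 A Ω) (testFunctions A Ω)

end OrliczSobolev

end

/-! Let K ⊆ Ω be the support of u. Cutting off near K shows that the extensions by zero of u and of
its weak derivatives still satisfy integration by parts, now on all of ℝ^N. Hence mollifying
commutes with differentiation (`partialDeriv_convolution`), and mollifications at radius at most δ,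
where the closed δ-neighbourhood of K lies in Ω, are test functions.

It remains to see that mollifications of f ∈ L_A with support in K converge weak*. By Fubini,
pairing ρ * f with v averages y ↦ ∫ f(x + y) v(x) dx against ρ, so continuity of this function at y
= 0 suffices (`tendsto_integral_translate_mul`). For bounded v it follows from continuity of
translation in L¹. For v ∈ E_Ā, take a bounded w close to v in Luxemburg norm: Young's inequality
bounds the contribution of v - w uniformly in y, because the modular of f on ℝ^N is translation
invariant. Translates need not converge in the norm of L_A; testing against E_Ā avoids this. -/

namespace OrliczSobolev

/-! ### N-functions, Young's inequality and translations -/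

theorem IsNFunction.map_zero {A : ℝ → ℝ} (hA : IsNFunction A) : A 0 = 0 := by
  obtain ⟨a, -, -, -, -, -, h⟩ := hA
  simp [h 0 le_rfl]

theorem IsNFunction.monotoneOn {A : ℝ → ℝ} (hA : IsNFunction A) : MonotoneOn A (Ici 0) := by
  obtain ⟨a, h0, hpos, hmono, -, -, h⟩ := hA
  have hint : ∀ s t : ℝ, 0 ≤ s → 0 ≤ t → IntervalIntegrable a volume s t := fun s t hs ht =>
    (hmono.mono fun x hx => (le_min hs ht).trans hx.1).intervalIntegrable
  intro s hs t ht hst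
  rw [h s hs, h t ht, ← sub_nonneg,
    intervalIntegral.integral_interval_sub_left (hint 0 t le_rfl ht) (hint 0 s le_rfl hs)]
  refine intervalIntegral.integral_nonneg hst fun x hx => ?_
  rw [← h0]
  exact hmono self_mem_Ici (mem_Ici.2 (le_trans hs hx.1)) (le_trans hs hx.1)

theorem IsNFunction.nonneg {A : ℝ → ℝ} (hA : IsNFunction A) {t : ℝ} (ht : 0 ≤ t) : 0 ≤ A t :=
  hA.map_zero ▸ hA.monotoneOn self_mem_Ici ht ht

/-- Since a → ∞, some T has a ≥ s on [T, ∞), and s t - A t cannot grow beyond T. Young's inequality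
depends on this bound: the real `sSup` of an unbounded set is 0. -/
theorem IsNFunction.bddAbove {A : ℝ → ℝ} (hA : IsNFunction A) (s : ℝ) :
    BddAbove ((fun t : ℝ => s * t - A t) '' Ici 0) := by
  have hA' := hA
  obtain ⟨a, h0, hpos, hmono, -, hlim, h⟩ := hA
  have hint : ∀ s t : ℝ, 0 ≤ s → 0 ≤ t → IntervalIntegrable a volume s t := fun s t hs ht =>
    (hmono.mono fun x hx => (le_min hs ht).trans hx.1).intervalIntegrable
  obtain ⟨T, hT0, hT⟩ := ((eventually_ge_atTop (0 : ℝ)).and (hlim.eventually_ge_atTop s)).exists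
  refine ⟨|s| * T, ?_⟩
  rintro _ ⟨t, ht, rfl⟩
  have ht : 0 ≤ t := ht
  have hs := le_abs_self s
  have hs' := abs_nonneg s
  rcases le_total t T with htT | htT
  · have := hA'.nonneg ht
    have h1 : s * t ≤ |s| * t := mul_le_mul_of_nonneg_right hs ht
    have h2 : |s| * t ≤ |s| * T := mul_le_mul_of_nonneg_left htT hs'
    simp only
    linarith
  · have h1 : A t - A T = ∫ x in T..t, a x := by
      rw [h t ht, h T hT0,
        intervalIntegral.integral_interval_sub_left (hint 0 t le_rfl ht) (hint 0 T le_rfl hT0)]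
    have h2 : ∫ _ in T..t, s ≤ ∫ x in T..t, a x := by
      refine intervalIntegral.integral_mono_on htT (by simp) (hint T t hT0 ht) fun x hx => ?_
      exact hT.trans (hmono hT0 (hT0.trans hx.1) hx.1)
    rw [intervalIntegral.integral_const, smul_eq_mul] at h2
    have h3 := hA'.nonneg hT0
    have h4 : s * T ≤ |s| * T := mul_le_mul_of_nonneg_right hs hT0
    simp only
    linarith

/-- Young's inequality. -/
theorem IsNFunction.young {A : ℝ → ℝ} (hA : IsNFunction A) {t : ℝ} (ht : 0 ≤ t) (s : ℝ) :
    t * s ≤ A t + complementary A s := by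
  have := le_csSup (hA.bddAbove s) (mem_image_of_mem (fun t : ℝ => s * t - A t) (mem_Ici.2 ht))
  unfold complementary
  linarith

theorem IsNFunction.complementary_nonneg {A : ℝ → ℝ} (hA : IsNFunction A) (s : ℝ) :
    0 ≤ complementary A s := by
  simpa [hA.map_zero] using hA.young le_rfl s

theorem IsNFunction.measurable_comp {A : ℝ → ℝ} (hA : IsNFunction A) {α : Type*}
    [MeasurableSpace α] {f : α → ℝ} (hf : Measurable f) (hf0 : ∀ x, 0 ≤ f x) :
    Measurable fun x => A (f x) := by
  -- `A` is arbitrary on negative numbers, so the argument is truncated at 0 to get a globally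
  -- monotone function.
  have hm : Monotone fun t : ℝ => A (max t 0) := fun s t hst =>
    hA.monotoneOn (mem_Ici.2 (le_max_right _ _)) (mem_Ici.2 (le_max_right _ _))
      (max_le_max_right 0 hst)
  have : (fun x => A (f x)) = fun x => A (max (f x) 0) := by
    funext x; rw [max_eq_left (hf0 x)]
  rw [this]
  exact hm.measurable.comp hf

/-- The integrated form of Young's inequality, with scaling parameters. -/
theorem IsNFunction.lintegral_mul_le {A : ℝ → ℝ} (hA : IsNFunction A) {α : Type*}
    [MeasurableSpace α] (μ : Measure α) {f : α → ℝ} (hf : Measurable f) (h : α → ℝ) {c d : ℝ}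
    (hc : 0 < c) (hd : 0 < d) :
    ∫⁻ x, ‖f x * h x‖ₑ ∂μ ≤ ENNReal.ofReal (c * d) *
      (∫⁻ x, ENNReal.ofReal (A (|f x| / c)) ∂μ +
        ∫⁻ x, ENNReal.ofReal (complementary A (|h x| / d)) ∂μ) := by
  -- Additivity of the integral needs only one measurable summand, so no measurability of
  -- `complementary A` or `h` enters.
  have hm : Measurable fun x => ENNReal.ofReal (A (|f x| / c)) :=
    (hA.measurable_comp ((measurable_norm.comp hf).div_const c)
      fun x => div_nonneg (norm_nonneg _) hc.le).ennreal_ofReal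
  rw [← lintegral_add_left hm, ← lintegral_const_mul' _ _ ENNReal.ofReal_ne_top]
  refine lintegral_mono fun x => ?_
  have h1 : 0 ≤ |f x| / c := div_nonneg (abs_nonneg _) hc.le
  rw [← ENNReal.ofReal_add (hA.nonneg h1) (hA.complementary_nonneg _),
    ← ENNReal.ofReal_mul (mul_pos hc hd).le, ← ofReal_norm]
  refine ENNReal.ofReal_le_ofReal ?_
  calc ‖f x * h x‖ = c * d * (|f x| / c * (|h x| / d)) := by
        rw [norm_mul, Real.norm_eq_abs, Real.norm_eq_abs]; field_simp
    _ ≤ _ := mul_le_mul_of_nonneg_left (hA.young h1 _) (mul_pos hc hd).le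

/-- Young's inequality against the constant 1, whose complementary modular is finite on a finite
measure space. -/
theorem IsNFunction.integrable_of_modular {A : ℝ → ℝ} (hA : IsNFunction A) {α : Type*}
    [MeasurableSpace α] (μ : Measure α) [IsFiniteMeasure μ] {f : α → ℝ}
    (hf : StronglyMeasurable f) {c : ℝ} (hc : 0 < c)
    (hfin : ∫⁻ x, ENNReal.ofReal (A (|f x| / c)) ∂μ < ⊤) : Integrable f μ := by
  refine ⟨hf.aestronglyMeasurable, ?_⟩
  have := hA.lintegral_mul_le μ hf.measurable (fun _ => 1) hc one_pos
  simp only [mul_one, lintegral_const] at this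
  exact this.trans_lt (ENNReal.mul_lt_top ENNReal.ofReal_lt_top
    (ENNReal.add_lt_top.2 ⟨hfin, ENNReal.mul_lt_top ENNReal.ofReal_lt_top (measure_lt_top _ _)⟩))

/-- The integrals of `|f(· + y)|` against `|h|` are bounded by the modulars of `f` and `h`. -/
theorem IsNFunction.lintegral_translate_mul_le {A : ℝ → ℝ} (hA : IsNFunction A) {N : ℕ}
    (S : Set (EuclideanSpace ℝ (Fin N))) {f : EuclideanSpace ℝ (Fin N) → ℝ} (hf : Measurable f)
    (h : EuclideanSpace ℝ (Fin N) → ℝ) {c d : ℝ} (hc : 0 < c) (hd : 0 < d)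
    (hd1 : ∫⁻ x in S, ENNReal.ofReal (complementary A (|h x| / d)) ≤ 1)
    (y : EuclideanSpace ℝ (Fin N)) :
    ∫⁻ x in S, ‖f (x + y) * h x‖ₑ ≤ ENNReal.ofReal (c * d) *
      ((∫⁻ x, ENNReal.ofReal (A (|f x| / c))) + 1) := by
  refine (hA.lintegral_mul_le _ (hf.comp (measurable_add_const y)) h hc hd).trans ?_
  refine mul_le_mul_right (add_le_add ?_ hd1) _
  -- Passing from S to the whole space makes the modular translation invariant, so the bound is
  -- independent of y.
  refine (setLIntegral_le_lintegral _ _).trans_eq ?_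
  exact lintegral_add_right_eq_self (fun x => ENNReal.ofReal (A (|f x| / c))) y

/-- Translation is continuous in `L¹`. -/
theorem tendsto_integral_norm_translate_sub {N : ℕ} {f : EuclideanSpace ℝ (Fin N) → ℝ}
    (hf : Integrable f) :
    Tendsto (fun y => ∫ x, ‖f (x + y) - f x‖) (𝓝 0) (𝓝 0) := by
  let F : Lp ℝ 1 (volume : Measure (EuclideanSpace ℝ (Fin N))) := hf.toL1 f
  -- The translations form a continuous family in the compact-open topology, as needed for
  -- continuity of composition on `Lp` with finite exponent.
  let g : C(EuclideanSpace ℝ (Fin N), C(EuclideanSpace ℝ (Fin N), EuclideanSpace ℝ (Fin N))) :=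
    (ContinuousMap.mk (fun a : EuclideanSpace ℝ (Fin N) × EuclideanSpace ℝ (Fin N) =>
      a.2 + a.1) (by fun_prop)).curry
  have hg : ∀ y, MeasurePreserving (g y) volume volume := fun y =>
    measurePreserving_add_right volume y
  have hcont : Continuous fun y => Lp.compMeasurePreserving (g y) (hg y) F :=
    continuous_const.compMeasurePreservingLp g.continuous hg ENNReal.one_ne_top
  have hF : ∀ y, (Lp.compMeasurePreserving (g y) (hg y) F : EuclideanSpace ℝ (Fin N) → ℝ)
      =ᵐ[volume] fun x => f (x + y) := fun y =>
    (Lp.coeFn_compMeasurePreserving F (hg y)).trans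
      ((hg y).quasiMeasurePreserving.ae_eq_comp hf.coeFn_toL1)
  have h1 : ∀ y, ∫ x, ‖f (x + y) - f x‖ =
      dist (Lp.compMeasurePreserving (g y) (hg y) F) F := by
    intro y
    rw [dist_eq_norm, L1.norm_eq_integral_norm]
    refine integral_congr_ae ?_
    filter_upwards [hF y, hf.coeFn_toL1,
      Lp.coeFn_sub (Lp.compMeasurePreserving (g y) (hg y) F) F] with x hx1 hx2 hx3
    rw [hx3, Pi.sub_apply, hx1]
    simp only [F, hx2]
  have h0 : Lp.compMeasurePreserving (g 0) (hg 0) F = F := by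
    refine Lp.ext ((hF 0).trans ?_)
    simp only [add_zero]
    exact hf.coeFn_toL1.symm
  have h2 := (hcont.tendsto 0).dist (tendsto_const_nhds (x := F))
  rw [h0, dist_self] at h2
  simpa only [h1] using h2

/-- `v` is approximated on `S` by bounded functions in the Luxemburg norm of `B`. -/
def BoundedApprox (B : ℝ → ℝ) {N : ℕ} (S : Set (EuclideanSpace ℝ (Fin N)))
    (v : EuclideanSpace ℝ (Fin N) → ℝ) : Prop :=
  ∀ δ : ℝ, 0 < δ → ∃ (w : EuclideanSpace ℝ (Fin N) → ℝ) (C d : ℝ), StronglyMeasurable w ∧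
    (∀ᵐ x ∂volume.restrict S, |w x| ≤ C) ∧ 0 < d ∧ d < δ ∧
      ∫⁻ x in S, ENNReal.ofReal (B (|v x - w x| / d)) ≤ 1

/-! ### Translates and mollifications paired with boundedly approximable functions -/

section Translate

variable {A : ℝ → ℝ} {N : ℕ} {S : Set (EuclideanSpace ℝ (Fin N))}
  {f v : EuclideanSpace ℝ (Fin N) → ℝ} {c : ℝ}

/-- The factor d makes the pairing small, uniformly in y, when h = v - w is small in Luxemburg norm.
-/
theorem IsNFunction.integrable_translate_mul (hA : IsNFunction A) (hfm : StronglyMeasurable f)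
    (hc : 0 < c) (hfA : ∫⁻ x, ENNReal.ofReal (A (|f x| / c)) < ⊤)
    {h : EuclideanSpace ℝ (Fin N) → ℝ} (hh : StronglyMeasurable h) {d : ℝ} (hd : 0 < d)
    (hd1 : ∫⁻ x in S, ENNReal.ofReal (complementary A (|h x| / d)) ≤ 1)
    (y : EuclideanSpace ℝ (Fin N)) :
    Integrable (fun x => f (x + y) * h x) (volume.restrict S) ∧
      ∫ x in S, ‖f (x + y) * h x‖ ≤
        c * d * ((∫⁻ x, ENNReal.ofReal (A (|f x| / c))).toReal + 1) := by
  have hm : StronglyMeasurable fun x => f (x + y) * h x :=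
    (hfm.comp_measurable (measurable_add_const y)).mul hh
  have hle := hA.lintegral_translate_mul_le S hfm.measurable h hc hd hd1 y
  have hfin : ENNReal.ofReal (c * d) * ((∫⁻ x, ENNReal.ofReal (A (|f x| / c))) + 1) < ⊤ :=
    ENNReal.mul_lt_top ENNReal.ofReal_lt_top (ENNReal.add_lt_top.2 ⟨hfA, ENNReal.one_lt_top⟩)
  refine ⟨⟨hm.aestronglyMeasurable, hle.trans_lt hfin⟩, ?_⟩
  rw [integral_norm_eq_lintegral_enorm hm.aestronglyMeasurable]
  refine (ENNReal.toReal_mono hfin.ne hle).trans_eq ?_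
  rw [ENNReal.toReal_mul, ENNReal.toReal_ofReal (mul_pos hc hd).le,
    ENNReal.toReal_add hfA.ne ENNReal.one_ne_top, ENNReal.toReal_one]

theorem integrable_translate_mul_of_bounded (hf : Integrable f)
    {w : EuclideanSpace ℝ (Fin N) → ℝ} (hw : StronglyMeasurable w) {C : ℝ}
    (hwC : ∀ᵐ x ∂volume.restrict S, |w x| ≤ C) (y : EuclideanSpace ℝ (Fin N)) :
    Integrable (fun x => f (x + y) * w x) (volume.restrict S) := by
  have := (hf.comp_add_right y).restrict (s := S)
  exact this.mul_bdd (c := C) hw.aestronglyMeasurable hwC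

/-- Split v = w + (v - w): the L¹ norm of f handles w, Young's inequality the remainder. Uniformity
in y is what Fubini requires later. -/
theorem IsNFunction.integrable_translate_mul_of_boundedApprox (hA : IsNFunction A)
    (hfm : StronglyMeasurable f) (hf : Integrable f)
    (hc : 0 < c) (hfA : ∫⁻ x, ENNReal.ofReal (A (|f x| / c)) < ⊤)
    (hvm : StronglyMeasurable v) (hv : BoundedApprox (complementary A) S v) :
    (∀ y, Integrable (fun x => f (x + y) * v x) (volume.restrict S)) ∧
      ∃ B, ∀ y, ∫ x in S, ‖f (x + y) * v x‖ ≤ B := by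
  obtain ⟨w, C, d, hw, hwC, hd, -, hd1⟩ := hv 1 one_pos
  have h1 := integrable_translate_mul_of_bounded (S := S) hf hw hwC
  have h2 := hA.integrable_translate_mul hfm hc hfA (hvm.sub hw) hd hd1
  have heq : ∀ y, (fun x => f (x + y) * v x) =
      fun x => f (x + y) * w x + f (x + y) * (v - w) x := fun y => by
    funext x; simp only [Pi.sub_apply]; ring
  refine ⟨fun y => by rw [heq y]; exact (h1 y).add (h2 y).1,
    |C| * (∫ x, ‖f x‖) + c * d * ((∫⁻ x, ENNReal.ofReal (A (|f x| / c))).toReal + 1),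
    fun y => ?_⟩
  have h3 : ∫ x in S, ‖f (x + y) * w x‖ ≤ |C| * ∫ x, ‖f x‖ := by
    have hfy : Integrable fun x => |C| * ‖f (x + y)‖ :=
      (hf.comp_add_right y).norm.const_mul _
    calc ∫ x in S, ‖f (x + y) * w x‖ ≤ ∫ x in S, |C| * ‖f (x + y)‖ := by
          refine integral_mono_ae (h1 y).norm hfy.restrict ?_
          filter_upwards [hwC] with x hx
          rw [norm_mul, mul_comm]
          exact mul_le_mul_of_nonneg_right (hx.trans (le_abs_self C)) (norm_nonneg _)
      _ ≤ ∫ x, |C| * ‖f (x + y)‖ :=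
          setIntegral_le_integral hfy (.of_forall fun x => by positivity)
      _ = |C| * ∫ x, ‖f x‖ := by
          rw [integral_const_mul, integral_add_right_eq_self (fun x => ‖f x‖) y]
  calc ∫ x in S, ‖f (x + y) * v x‖
      ≤ ∫ x in S, (‖f (x + y) * w x‖ + ‖f (x + y) * (v - w) x‖) := by
        refine integral_mono (show Integrable (fun x => f (x + y) * v x) _ by
          rw [heq y]; exact (h1 y).add (h2 y).1).norm
          ((h1 y).norm.add (h2 y).1.norm) fun x => ?_
        simp only
        rw [congrFun (heq y) x]
        exact norm_add_le _ _
    _ = _ := integral_add (h1 y).norm (h2 y).1.norm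
    _ ≤ _ := add_le_add h3 (h2 y).2

/-- Translation is weak* continuous at `0`. -/
theorem IsNFunction.tendsto_integral_translate_mul (hA : IsNFunction A)
    (hfm : StronglyMeasurable f) (hf : Integrable f)
    (hc : 0 < c) (hfA : ∫⁻ x, ENNReal.ofReal (A (|f x| / c)) < ⊤)
    (hvm : StronglyMeasurable v) (hv : BoundedApprox (complementary A) S v) :
    Tendsto (fun y => ∫ x in S, f (x + y) * v x) (𝓝 0) (𝓝 (∫ x in S, f x * v x)) := by
  set M := (∫⁻ x, ENNReal.ofReal (A (|f x| / c))).toReal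
  have hM0 : 0 ≤ M := ENNReal.toReal_nonneg
  rw [Metric.tendsto_nhds]
  intro ε hε
  have hK : 0 < 4 * (c * (M + 1)) := by positivity
  -- This threshold makes each of the two remainders (at y and at 0) less than ε / 4, leaving ε / 2
  -- for the bounded part.
  obtain ⟨w, C, d, hw, hwC, hd, hdδ, hd1⟩ := hv (ε / (4 * (c * (M + 1)))) (by positivity)
  have hdε : c * d * (M + 1) < ε / 4 := by
    rw [lt_div_iff₀ hK] at hdδ
    linarith
  have h1 := integrable_translate_mul_of_bounded (S := S) hf hw hwC
  have h2 := hA.integrable_translate_mul hfm hc hfA (hvm.sub hw) hd hd1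
  have h3 := (tendsto_integral_norm_translate_sub hf).eventually
    (gt_mem_nhds (show 0 < ε / (2 * (|C| + 1)) by positivity))
  filter_upwards [h3] with y hy
  have hsplit : ∀ y, ∫ x in S, f (x + y) * v x =
      (∫ x in S, f (x + y) * w x) + ∫ x in S, f (x + y) * (v - w) x := fun y => by
    rw [← integral_add (h1 y) (h2 y).1]
    congr 1; funext x; simp only [Pi.sub_apply]; ring
  have hb : ∀ y, ‖∫ x in S, f (x + y) * (v - w) x‖ < ε / 4 := fun y =>
    ((norm_integral_le_integral_norm _).trans (h2 y).2).trans_lt hdε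
  have hdiff : ‖(∫ x in S, f (x + y) * w x) - ∫ x in S, f (x + 0) * w x‖ ≤ ε / 2 := by
    rw [← integral_sub (h1 y) (h1 0)]
    have hi : Integrable fun x => |C| * ‖f (x + y) - f x‖ :=
      ((hf.comp_add_right y).sub hf).norm.const_mul _
    calc ‖∫ x in S, (f (x + y) * w x - f (x + 0) * w x)‖
        ≤ ∫ x in S, |C| * ‖f (x + y) - f x‖ := by
          refine norm_integral_le_of_norm_le hi.restrict ?_
          filter_upwards [hwC] with x hx
          rw [add_zero, ← sub_mul, norm_mul, mul_comm]
          exact mul_le_mul_of_nonneg_right (hx.trans (le_abs_self C)) (norm_nonneg _)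
      _ ≤ ∫ x, |C| * ‖f (x + y) - f x‖ :=
          setIntegral_le_integral hi (.of_forall fun x => by positivity)
      _ = |C| * ∫ x, ‖f (x + y) - f x‖ := integral_const_mul _ _
      _ ≤ (|C| + 1) * (ε / (2 * (|C| + 1))) :=
          mul_le_mul (by linarith) hy.le (integral_nonneg fun x => norm_nonneg _) (by positivity)
      _ = ε / 2 := by field_simp
  have hz := hsplit 0
  simp only [add_zero] at hz
  have hb0 := hb 0
  simp only [add_zero] at hb0 hdiff
  have hby := hb y
  rw [Real.dist_eq, hsplit y, hz]
  rw [Real.norm_eq_abs] at hb0 hby hdiff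
  rw [abs_lt] at *
  rw [abs_le] at hdiff
  constructor <;> linarith [hb0.1, hb0.2, hby.1, hby.2, hdiff.1, hdiff.2]

/-- Pairing a mollification of `f` with `v` amounts to averaging the pairings of the translates. -/
theorem IsNFunction.integral_convolution_mul (hA : IsNFunction A)
    (hfm : StronglyMeasurable f) (hf : Integrable f)
    (hc : 0 < c) (hfA : ∫⁻ x, ENNReal.ofReal (A (|f x| / c)) < ⊤)
    (hvm : StronglyMeasurable v) (hv : BoundedApprox (complementary A) S v)
    {ρ : EuclideanSpace ℝ (Fin N) → ℝ} (hρm : StronglyMeasurable ρ) (hρ : Integrable ρ) :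
    ∫ x in S, convolution ρ f (ContinuousLinearMap.lsmul ℝ ℝ) volume x * v x =
      convolution ρ (fun y => ∫ x in S, f (x + y) * v x) (ContinuousLinearMap.lsmul ℝ ℝ)
        volume 0 := by
  obtain ⟨hint, B, hB⟩ := hA.integrable_translate_mul_of_boundedApprox hfm hf hc hfA hvm hv
  have hm : StronglyMeasurable (Function.uncurry fun t x => ρ t * (f (x + -t) * v x)) := by
    refine (hρm.comp_measurable measurable_fst).mul
      ((hfm.comp_measurable ?_).mul (hvm.comp_measurable measurable_snd))
    exact measurable_snd.add measurable_fst.neg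
  have hprod : Integrable (Function.uncurry fun t x => ρ t * (f (x + -t) * v x))
      (volume.prod (volume.restrict S)) := by
    rw [integrable_prod_iff hm.aestronglyMeasurable]
    refine ⟨.of_forall fun t => (hint (-t)).const_mul (ρ t), ?_⟩
    -- The inner integrals are dominated by B‖ρ t‖, with B independent of the translation.
    refine (hρ.norm.mul_const B).mono'
      hm.norm.integral_prod_right.aestronglyMeasurable (.of_forall fun t => ?_)
    rw [Real.norm_of_nonneg (integral_nonneg fun x => norm_nonneg _)]
    simp only [Function.uncurry, norm_mul (ρ t), integral_const_mul]
    exact mul_le_mul_of_nonneg_left (hB (-t)) (norm_nonneg _)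
  simp only [convolution, ContinuousLinearMap.lsmul_apply, smul_eq_mul, zero_sub]
  simp only [← integral_const_mul, ← integral_mul_const]
  rw [integral_integral_swap hprod]
  simp only [sub_eq_add_neg, mul_assoc]

/-- Mollifications converge weak* in the Orlicz space. -/
theorem IsNFunction.tendsto_integral_convolution_mul (hA : IsNFunction A)
    (hfm : StronglyMeasurable f) (hf : Integrable f)
    (hc : 0 < c) (hfA : ∫⁻ x, ENNReal.ofReal (A (|f x| / c)) < ⊤)
    (hvm : StronglyMeasurable v) (hv : BoundedApprox (complementary A) S v)
    {ι : Type*} {l : Filter ι} {φ : ι → ContDiffBump (0 : EuclideanSpace ℝ (Fin N))}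
    (hφ : Tendsto (fun i => (φ i).rOut) l (𝓝 0)) :
    Tendsto (fun i => ∫ x in S,
      convolution ((φ i).normed volume) f (ContinuousLinearMap.lsmul ℝ ℝ) volume x * v x) l
      (𝓝 (∫ x in S, f x * v x)) := by
  have h1 := fun i => hA.integral_convolution_mul (S := S) hfm hf hc hfA hvm hv
    (φ i).continuous_normed.stronglyMeasurable (φ i).integrable_normed
  simp only [h1]
  have hm : StronglyMeasurable fun y => ∫ x in S, f (x + y) * v x := by
    refine StronglyMeasurable.integral_prod_right'
      (f := Function.uncurry fun y x => f (x + y) * v x) ?_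
    exact (hfm.comp_measurable (measurable_snd.add measurable_fst)).mul
      (hvm.comp_measurable measurable_snd)
  exact ContDiffBump.convolution_tendsto_right hφ (.of_forall fun _ => hm.aestronglyMeasurable)
    ((hA.tendsto_integral_translate_mul hfm hf hc hfA hvm hv).comp tendsto_snd)
    tendsto_const_nhds

end Translate

/-! ### Weak derivatives: locality, extension by zero, mollification -/

section WeakDerivative

variable {N : ℕ} {Ω : Opens (EuclideanSpace ℝ (Fin N))}

theorem continuous_partialDeriv (i : Fin N) {ψ : EuclideanSpace ℝ (Fin N) → ℝ}
    (hψ : ContDiff ℝ (⊤ : ℕ∞) ψ) : Continuous (partialDeriv i ψ) :=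
  (hψ.continuous_fderiv (by simp)).clm_apply continuous_const

theorem tsupport_partialDeriv_subset (i : Fin N) (ψ : EuclideanSpace ℝ (Fin N) → ℝ) :
    tsupport (partialDeriv i ψ) ⊆ tsupport ψ := by
  refine closure_minimal (fun x hx => ?_) (isClosed_tsupport ψ)
  by_contra hx'
  refine hx ?_
  have : fderiv ℝ ψ x = 0 := by
    by_contra h
    exact hx' (tsupport_fderiv_subset ℝ (subset_tsupport _ h))
  simp [partialDeriv, this]

theorem hasCompactSupport_partialDeriv (i : Fin N) {ψ : EuclideanSpace ℝ (Fin N) → ℝ}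
    (hψ : HasCompactSupport ψ) : HasCompactSupport (partialDeriv i ψ) :=
  hψ.of_isClosed_subset (isClosed_tsupport _) (tsupport_partialDeriv_subset i ψ)

theorem integrable_mul_of_tsupport_subset {s : Set (EuclideanSpace ℝ (Fin N))}
    {u ψ : EuclideanSpace ℝ (Fin N) → ℝ} (hu : LocallyIntegrableOn u s volume)
    (hψ : Continuous ψ) (hc : HasCompactSupport ψ) (hs : tsupport ψ ⊆ s) :
    Integrable fun x => u x * ψ x := by
  have h1 : IntegrableOn (fun x => u x * ψ x) (tsupport ψ) volume :=
    (hu.integrableOn_compact_subset hs hc).mul_continuousOn hψ.continuousOn hc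
  refine (integrableOn_iff_integrable_of_support_subset ?_).1 h1
  exact (Function.support_mul_subset_right u ψ).trans (subset_tsupport ψ)

theorem setIntegral_mul_eq_integral {s : Set (EuclideanSpace ℝ (Fin N))}
    {u ψ : EuclideanSpace ℝ (Fin N) → ℝ} (hs : tsupport ψ ⊆ s) :
    ∫ x in s, u x * ψ x = ∫ x, u x * ψ x :=
  setIntegral_eq_integral_of_forall_compl_eq_zero fun x hx => by
    rw [image_eq_zero_of_notMem_tsupport fun h => hx (hs h), mul_zero]

/-- Weak derivatives of functions that agree on an open set agree there. -/
theorem HasWeakPartialDeriv.ae_eq_of_ae_eq {i : Fin N} {u g u' g' : MeasFun Ω}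
    (h : HasWeakPartialDeriv Ω i u g) (h' : HasWeakPartialDeriv Ω i u' g')
    {V : Set (EuclideanSpace ℝ (Fin N))} (hV : IsOpen V) (hVΩ : V ⊆ Ω)
    (huu' : ∀ᵐ x, x ∈ V → u x = u' x) : ∀ᵐ x, x ∈ V → g x = g' x := by
  have hloc : LocallyIntegrableOn (fun x => g x - g' x) V volume :=
    (h.2.1.mono_set hVΩ).sub (h'.2.1.mono_set hVΩ)
  -- Fundamental lemma of the calculus of variations for g - g' on V.
  have := hV.ae_eq_zero_of_integral_contDiff_smul_eq_zero hloc fun ψ hψ hc hs => ?_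
  · filter_upwards [this] with x hx hxV
    exact sub_eq_zero.1 (hx hxV)
  · have hsΩ := hs.trans hVΩ
    have e := h.2.2 ⟨ψ, hψ, hc, hsΩ⟩
    have e' := h'.2.2 ⟨ψ, hψ, hc, hsΩ⟩
    change ∫ x in (Ω : Set _), u x * partialDeriv i ψ x = - ∫ x in (Ω : Set _), g x * ψ x at e
    change ∫ x in (Ω : Set _), u' x * partialDeriv i ψ x = - ∫ x in (Ω : Set _), g' x * ψ x at e'
    have hpd := (tsupport_partialDeriv_subset i ψ).trans hsΩ
    rw [setIntegral_mul_eq_integral hsΩ, setIntegral_mul_eq_integral hpd] at e e'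
    have hu : ∫ x, u x * partialDeriv i ψ x = ∫ x, u' x * partialDeriv i ψ x := by
      refine integral_congr_ae ?_
      filter_upwards [huu'] with x hx
      by_cases hxV : x ∈ V
      · rw [hx hxV]
      · rw [image_eq_zero_of_notMem_tsupport fun hx' =>
          hxV (hs (tsupport_partialDeriv_subset i ψ hx')), mul_zero, mul_zero]
    have hsub : ∫ x, ψ x • (g x - g' x) = (∫ x, g x * ψ x) - ∫ x, g' x * ψ x := by
      rw [← integral_sub (integrable_mul_of_tsupport_subset h.2.1 hψ.continuous hc hsΩ)
        (integrable_mul_of_tsupport_subset h'.2.1 hψ.continuous hc hsΩ)]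
      congr 1; funext x; rw [smul_eq_mul]; ring
    rw [hsub]
    linarith

theorem HasWeakPartialDeriv.unique {i : Fin N} {u g g' : MeasFun Ω}
    (h : HasWeakPartialDeriv Ω i u g) (h' : HasWeakPartialDeriv Ω i u g') : g = g' :=
  AEEqFun.ext ((ae_restrict_iff' Ω.isOpen.measurableSet).2
    (h.ae_eq_of_ae_eq h' Ω.isOpen Subset.rfl (.of_forall fun _ _ => rfl)))

theorem locallyIntegrableOn_of_ae_eq {u f : EuclideanSpace ℝ (Fin N) → ℝ}
    {s : Set (EuclideanSpace ℝ (Fin N))} (hf : Integrable f) (h : u =ᵐ[volume.restrict s] f) :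
    LocallyIntegrableOn u s volume :=
  IntegrableOn.locallyIntegrableOn (hf.restrict.congr h.symm)

/-- The weak derivatives of a test function are its classical derivatives. -/
theorem hasWeakPartialDeriv_of_testFunction (i : Fin N) (φ : 𝓓(Ω, ℝ)) {u g : MeasFun Ω}
    (hu : u =ᵐ[volume.restrict (Ω : Set (EuclideanSpace ℝ (Fin N)))] φ)
    (hg : g =ᵐ[volume.restrict (Ω : Set (EuclideanSpace ℝ (Fin N)))] partialDeriv i φ) :
    HasWeakPartialDeriv Ω i u g := by
  have hφi : Integrable φ := φ.continuous.integrable_of_hasCompactSupport φ.hasCompactSupport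
  have hdc := continuous_partialDeriv i φ.contDiff
  have hdφi : Integrable (partialDeriv i φ) :=
    hdc.integrable_of_hasCompactSupport (hasCompactSupport_partialDeriv i φ.hasCompactSupport)
  refine ⟨locallyIntegrableOn_of_ae_eq hφi hu, locallyIntegrableOn_of_ae_eq hdφi hg, fun ψ => ?_⟩
  have h1 : ∫ x in (Ω : Set (EuclideanSpace ℝ (Fin N))), u x * partialDeriv i ψ x =
      ∫ x, φ x * partialDeriv i ψ x := by
    rw [← setIntegral_mul_eq_integral
      ((tsupport_partialDeriv_subset i ψ).trans ψ.tsupport_subset)]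
    refine integral_congr_ae ?_
    filter_upwards [hu] with x hx
    rw [hx]
  have h2 : ∫ x in (Ω : Set (EuclideanSpace ℝ (Fin N))), g x * ψ x =
      ∫ x, partialDeriv i φ x * ψ x := by
    rw [← setIntegral_mul_eq_integral ψ.tsupport_subset]
    refine integral_congr_ae ?_
    filter_upwards [hg] with x hx
    rw [hx]
  rw [h1, h2]
  refine integral_mul_fderiv_eq_neg_fderiv_mul_of_integrable ?_ ?_ ?_ ?_ ?_
  · exact (hdc.mul ψ.continuous).integrable_of_hasCompactSupport
      (HasCompactSupport.mul_left ψ.hasCompactSupport)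
  · exact (φ.continuous.mul (continuous_partialDeriv i ψ.contDiff)).integrable_of_hasCompactSupport
      (HasCompactSupport.mul_right φ.hasCompactSupport)
  · exact (φ.continuous.mul ψ.continuous).integrable_of_hasCompactSupport
      (HasCompactSupport.mul_left ψ.hasCompactSupport)
  · exact fun x _ => φ.contDiff.differentiable (by simp) x
  · exact fun x _ => ψ.contDiff.differentiable (by simp) x

/-- A weak derivative vanishes where the function does. -/
theorem HasWeakPartialDeriv.ae_eq_zero {i : Fin N} {u g : MeasFun Ω}
    (h : HasWeakPartialDeriv Ω i u g) {V : Set (EuclideanSpace ℝ (Fin N))} (hV : IsOpen V)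
    (hVΩ : V ⊆ Ω) (hu : ∀ᵐ x, x ∈ V → u x = 0) : ∀ᵐ x, x ∈ V → g x = 0 := by
  have hz : ((0 : MeasFun Ω) : EuclideanSpace ℝ (Fin N) → ℝ)
      =ᵐ[volume.restrict (Ω : Set (EuclideanSpace ℝ (Fin N)))] 0 := AEEqFun.coeFn_zero
  have h0 : HasWeakPartialDeriv Ω i 0 0 := by
    refine hasWeakPartialDeriv_of_testFunction i (0 : 𝓓(Ω, ℝ)) hz (hz.trans ?_)
    refine .of_forall fun x => ?_
    simp [partialDeriv]
  have hz' : ∀ᵐ x, x ∈ V → (0 : MeasFun Ω) x = 0 := by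
    filter_upwards [(ae_restrict_iff' Ω.isOpen.measurableSet).1 hz] with x hx hxV
    exact hx (hVΩ hxV)
  have := h.ae_eq_of_ae_eq h0 hV hVΩ (by
    filter_upwards [hu, hz'] with x h1 h2 hx
    rw [h1 hx, h2 hx])
  filter_upwards [this, hz'] with x h1 h2 hx
  rw [h1 hx, h2 hx]

/-- The extension by zero of a weakly differentiable function with compact support is weakly
differentiable. -/
theorem HasWeakPartialDeriv.integral_indicator {i : Fin N} {u g : MeasFun Ω}
    (h : HasWeakPartialDeriv Ω i u g) {K : Set (EuclideanSpace ℝ (Fin N))} (hK : IsCompact K)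
    (hKΩ : K ⊆ Ω) (hu : ∀ᵐ x, x ∈ (Ω : Set (EuclideanSpace ℝ (Fin N))) \ K → u x = 0)
    (hg : ∀ᵐ x, x ∈ (Ω : Set (EuclideanSpace ℝ (Fin N))) \ K → g x = 0)
    {ψ : EuclideanSpace ℝ (Fin N) → ℝ} (hψ : ContDiff ℝ (⊤ : ℕ∞) ψ) :
    ∫ x, K.indicator u x * partialDeriv i ψ x = - ∫ x, K.indicator g x * ψ x := by
  obtain ⟨s, hs, hKs, hsΩ, hsc⟩ := exists_open_between_and_isCompact_closure hK Ω.isOpen hKΩ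
  obtain ⟨χ, hχ, hrange, hsupp, hone⟩ := exists_contMDiff_support_eq_eq_one_iff
    (modelWithCornersSelf ℝ (EuclideanSpace ℝ (Fin N)))
    (M := EuclideanSpace ℝ (Fin N)) (n := ⊤) hs hK.isClosed hKs
  have hχ : ContDiff ℝ (⊤ : ℕ∞) χ := hχ.contDiff
  have hχs : tsupport χ = closure s := by rw [tsupport, hsupp]
  have hχc : HasCompactSupport χ := by rw [HasCompactSupport, hχs]; exact hsc
  -- ψ need not be supported in Ω, but χψ is an admissible test function.
  have e := h.2.2 ⟨fun x => χ x * ψ x, hχ.mul hψ, hχc.mul_right,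
    tsupport_mul_subset_left.trans (hχs.trans_subset hsΩ)⟩
  change ∫ x in (Ω : Set _), u x * partialDeriv i (fun x => χ x * ψ x) x =
    - ∫ x in (Ω : Set _), g x * (χ x * ψ x) at e
  have hind : ∀ (w v : EuclideanSpace ℝ (Fin N) → ℝ),
      ∫ x in (Ω : Set (EuclideanSpace ℝ (Fin N))), K.indicator w x * v x =
        ∫ x, K.indicator w x * v x := fun w v =>
    setIntegral_eq_integral_of_forall_compl_eq_zero fun x hx => by
      rw [indicator_of_notMem fun h => hx (hKΩ h), zero_mul]
  rw [← hind, ← hind]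
  refine (Eq.trans ?_ e).trans (congrArg Neg.neg (Eq.symm ?_))
  · refine setIntegral_congr_ae Ω.isOpen.measurableSet ?_
    filter_upwards [hu] with x hx hxΩ
    by_cases hxK : x ∈ K
    · have hmax : IsLocalMax χ x := .of_forall fun y => by
        rw [(hone x).1 hxK]; exact (hrange (mem_range_self y)).2
      rw [indicator_of_mem hxK, partialDeriv, partialDeriv,
        fderiv_fun_mul (hχ.differentiable (by simp) x) (hψ.differentiable (by simp) x),
        hmax.fderiv_eq_zero, (hone x).1 hxK]
      simp
    · rw [indicator_of_notMem hxK, hx ⟨hxΩ, hxK⟩, zero_mul, zero_mul]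
  · refine setIntegral_congr_ae Ω.isOpen.measurableSet ?_
    filter_upwards [hg] with x hx hxΩ
    by_cases hxK : x ∈ K
    · rw [indicator_of_mem hxK, (hone x).1 hxK, one_mul]
    · rw [indicator_of_notMem hxK, hx ⟨hxΩ, hxK⟩, zero_mul, zero_mul]

/-- The derivative of a mollification is the mollification of the weak derivative. -/
theorem partialDeriv_convolution {i : Fin N} {u g ρ : EuclideanSpace ℝ (Fin N) → ℝ}
    (hu : LocallyIntegrable u)
    (hug : ∀ ψ : EuclideanSpace ℝ (Fin N) → ℝ, ContDiff ℝ (⊤ : ℕ∞) ψ →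
      ∫ x, u x * partialDeriv i ψ x = - ∫ x, g x * ψ x)
    (hρ : ContDiff ℝ (⊤ : ℕ∞) ρ) (hρc : HasCompactSupport ρ) (x : EuclideanSpace ℝ (Fin N)) :
    partialDeriv i (convolution ρ u (ContinuousLinearMap.lsmul ℝ ℝ) volume) x =
      convolution ρ g (ContinuousLinearMap.lsmul ℝ ℝ) volume x := by
  -- The flip puts the smooth factor ρ on the right, so that the derivative falls on it.
  have hd := hρc.hasFDerivAt_convolution_right (ContinuousLinearMap.lsmul ℝ ℝ).flip hu
    (hρ.of_le (by simp)) x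
  rw [convolution_flip] at hd
  rw [partialDeriv, hd.fderiv, convolution_precompR_apply _ hu (hρc.fderiv ℝ)
    (hρ.continuous_fderiv (by simp))]
  have hψ : ∀ t, partialDeriv i (fun t => ρ (x - t)) t =
      - fderiv ℝ ρ (x - t) (EuclideanSpace.single i 1) := fun t => by
    have h1 : HasFDerivAt (fun t => x - t) (-ContinuousLinearMap.id ℝ _) t :=
      (hasFDerivAt_id t).const_sub x
    have h2 := ((hρ.differentiable (by simp) (x - t)).hasFDerivAt).comp t h1
    rw [partialDeriv, HasFDerivAt.fderiv (f := fun t => ρ (x - t)) h2]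
    simp
  -- The sign from differentiating the reflected bump cancels the one in the definition of the weak
  -- derivative.
  have e := hug (fun t => ρ (x - t)) (hρ.comp (contDiff_const.sub contDiff_id))
  simp only [hψ, mul_neg, integral_neg, neg_inj] at e
  rw [← convolution_flip (ContinuousLinearMap.lsmul ℝ ℝ)]
  simp only [convolution, ContinuousLinearMap.flip_apply, ContinuousLinearMap.lsmul_apply,
    smul_eq_mul]
  simpa only [mul_comm] using e

end WeakDerivative

/-! ### Approximation by test functions -/

section Approximation

variable {A : ℝ → ℝ} {N : ℕ} {Ω : Opens (EuclideanSpace ℝ (Fin N))}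

/-- A set that is null near each of its points is null, by second countability. -/
theorem ae_eq_zero_of_notMem_essSupport (u : MeasFun Ω) :
    ∀ᵐ x, x ∈ (Ω : Set (EuclideanSpace ℝ (Fin N))) \ essSupport Ω u → u x = 0 := by
  have hnull : (volume.restrict (Ω : Set (EuclideanSpace ℝ (Fin N))))
      {x | x ∉ essSupport Ω u ∧ u x ≠ 0} = 0 := by
    refine measure_null_of_locally_null _ fun x hx => ?_
    obtain ⟨U, hU, h⟩ : ∃ U ∈ 𝓝 x,
        ∀ᵐ y ∂(volume.restrict (Ω : Set (EuclideanSpace ℝ (Fin N)))), y ∈ U → u y = 0 := by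
      by_contra hcon
      exact hx.1 fun U hU h => hcon ⟨U, hU, h⟩
    refine ⟨U ∩ {x | x ∉ essSupport Ω u ∧ u x ≠ 0},
      inter_mem (mem_nhdsWithin_of_mem_nhds hU) self_mem_nhdsWithin, ?_⟩
    refine measure_mono_null (fun y hy => ?_) h
    exact fun h' => hy.2.2 (h' hy.1)
  have := (ae_restrict_iff' Ω.isOpen.measurableSet).1 (measure_eq_zero_iff_ae_notMem.1 hnull)
  filter_upwards [this] with x hx hxΩ
  by_contra hne
  exact hx hxΩ.1 ⟨hxΩ.2, hne⟩

theorem boundedApprox_of_mem_EOrlicz {B : ℝ → ℝ} {v : MeasFun Ω} (hv : v ∈ EOrlicz B Ω) :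
    BoundedApprox B (Ω : Set (EuclideanSpace ℝ (Fin N))) v := by
  intro δ hδ
  obtain ⟨w, ⟨⟨C, hC⟩, -⟩, -, hw⟩ := hv.2 (ENNReal.ofReal δ) (ENNReal.ofReal_pos.2 hδ)
  simp only [luxemburgNorm, iInf_lt_iff] at hw
  obtain ⟨d, ⟨hd, hd1⟩, hdδ⟩ := hw
  refine ⟨w, C, d, w.stronglyMeasurable, hC, hd, (ENNReal.ofReal_lt_ofReal_iff hδ).1 hdδ, ?_⟩
  refine (lintegral_congr_ae ?_).trans_le hd1
  filter_upwards [AEEqFun.coeFn_sub v w] with x hx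
  rw [hx, Pi.sub_apply]

theorem IsNFunction.mem_orliczSpace_of_ae_eq (hA : IsNFunction A)
    {φ : EuclideanSpace ℝ (Fin N) → ℝ} (hφ : Continuous φ) (hc : HasCompactSupport φ)
    {u : MeasFun Ω} (hu : u =ᵐ[volume.restrict (Ω : Set (EuclideanSpace ℝ (Fin N)))] φ) :
    u ∈ OrliczSpace A Ω := by
  obtain ⟨C, hC⟩ := hφ.bounded_above_of_compact_support hc
  refine ⟨1, one_pos, ?_⟩
  calc modular A Ω u 1
      ≤ ∫⁻ x in (Ω : Set (EuclideanSpace ℝ (Fin N))),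
          (tsupport φ).indicator (fun _ => ENNReal.ofReal (A C)) x := by
        refine lintegral_mono_ae ?_
        filter_upwards [hu] with x hx
        rw [hx, div_one]
        by_cases hxs : x ∈ tsupport φ
        · rw [indicator_of_mem hxs]
          exact ENNReal.ofReal_le_ofReal (hA.monotoneOn (mem_Ici.2 (abs_nonneg _))
            (mem_Ici.2 ((norm_nonneg _).trans (hC x))) (hC x))
        · rw [image_eq_zero_of_notMem_tsupport hxs, abs_zero, hA.map_zero, ENNReal.ofReal_zero]
          exact zero_le
    _ ≤ ∫⁻ x, (tsupport φ).indicator (fun _ => ENNReal.ofReal (A C)) x :=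
        setLIntegral_le_lintegral _ _
    _ = ENNReal.ofReal (A C) * volume (tsupport φ) :=
        lintegral_indicator_const (isClosed_tsupport φ).measurableSet _
    _ < ⊤ := ENNReal.mul_lt_top ENNReal.ofReal_lt_top hc.measure_lt_top

/-- A test function as an element of `W^1 L_A(Ω)`. -/
noncomputable def IsNFunction.ofTestFunction (hA : IsNFunction A) (φ : 𝓓(Ω, ℝ)) : W1Orlicz A Ω :=
  ⟨AEEqFun.mk φ φ.continuous.aestronglyMeasurable,
    hA.mem_orliczSpace_of_ae_eq φ.continuous φ.hasCompactSupport (AEEqFun.coeFn_mk _ _),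
    fun i => ⟨AEEqFun.mk (partialDeriv i φ)
        (continuous_partialDeriv i φ.contDiff).aestronglyMeasurable,
      hA.mem_orliczSpace_of_ae_eq (continuous_partialDeriv i φ.contDiff)
        (hasCompactSupport_partialDeriv i φ.hasCompactSupport) (AEEqFun.coeFn_mk _ _),
      hasWeakPartialDeriv_of_testFunction i φ (AEEqFun.coeFn_mk _ _) (AEEqFun.coeFn_mk _ _)⟩⟩

theorem IsNFunction.coe_ofTestFunction (hA : IsNFunction A) (φ : 𝓓(Ω, ℝ)) :
    (hA.ofTestFunction φ).1 =ᵐ[volume.restrict (Ω : Set (EuclideanSpace ℝ (Fin N)))] φ :=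
  AEEqFun.coeFn_mk _ _

theorem weakPartial_spec (u : W1Orlicz A Ω) (i : Fin N) :
    HasWeakPartialDeriv Ω i u.1 (weakPartial u i).1 :=
  (u.2.2 i).choose_spec.2

/-- `weakPartial` is an arbitrary choice; uniqueness of weak derivatives identifies it. -/
theorem IsNFunction.weakPartial_ofTestFunction (hA : IsNFunction A) (φ : 𝓓(Ω, ℝ)) (i : Fin N) :
    (weakPartial (hA.ofTestFunction φ) i).1
      =ᵐ[volume.restrict (Ω : Set (EuclideanSpace ℝ (Fin N)))] partialDeriv i φ := by
  have hm := AEEqFun.coeFn_mk (μ := volume.restrict (Ω : Set (EuclideanSpace ℝ (Fin N))))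
    (partialDeriv i φ) (continuous_partialDeriv i φ.contDiff).aestronglyMeasurable
  rw [(weakPartial_spec (hA.ofTestFunction φ) i).unique
    (hasWeakPartialDeriv_of_testFunction i φ (hA.coe_ofTestFunction φ) hm)]
  exact hm

/-- The extension by zero of an Orlicz function supported in the compact set `K`. -/
theorem IsNFunction.exists_modular_indicator_lt_top (hA : IsNFunction A) {u : MeasFun Ω}
    (hu : u ∈ OrliczSpace A Ω) {K : Set (EuclideanSpace ℝ (Fin N))} (hK : IsCompact K)
    (hKΩ : K ⊆ Ω) :
    StronglyMeasurable (K.indicator u) ∧ Integrable (K.indicator u) ∧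
      ∃ c : ℝ, 0 < c ∧ ∫⁻ x, ENNReal.ofReal (A (|K.indicator u x| / c)) < ⊤ := by
  obtain ⟨c, hc, hfin⟩ := hu
  have hKfin : ∫⁻ x in K, ENNReal.ofReal (A (|u x| / c)) < ⊤ :=
    (lintegral_mono_set hKΩ).trans_lt hfin
  have : IsFiniteMeasure (volume.restrict K) := ⟨by simpa using hK.measure_lt_top⟩
  refine ⟨u.stronglyMeasurable.indicator hK.measurableSet, ?_, c, hc, ?_⟩
  · exact (integrable_indicator_iff hK.measurableSet).2
      (hA.integrable_of_modular _ u.stronglyMeasurable hc hKfin)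
  · rw [← lintegral_indicator hK.measurableSet] at hKfin
    refine lt_of_eq_of_lt (lintegral_congr fun x => ?_) hKfin
    by_cases hx : x ∈ K
    · rw [indicator_of_mem hx, indicator_of_mem hx]
    · rw [indicator_of_notMem hx, indicator_of_notMem hx, abs_zero, zero_div, hA.map_zero,
        ENNReal.ofReal_zero]

/-- Convergence of a single component of the pairing, applied to u and to each weak derivative
alike. -/
theorem IsNFunction.tendsto_pairing_of_ae_eq_convolution (hA : IsNFunction A) {u : MeasFun Ω}
    (hu : u ∈ OrliczSpace A Ω) {K : Set (EuclideanSpace ℝ (Fin N))} (hK : IsCompact K)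
    (hKΩ : K ⊆ Ω) (hu0 : ∀ᵐ x, x ∈ (Ω : Set (EuclideanSpace ℝ (Fin N))) \ K → u x = 0)
    {ι : Type*} {l : Filter ι} {φ : ι → ContDiffBump (0 : EuclideanSpace ℝ (Fin N))}
    (hφ : Tendsto (fun i => (φ i).rOut) l (𝓝 0)) {w : ι → MeasFun Ω}
    (hw : ∀ i, w i =ᵐ[volume.restrict (Ω : Set (EuclideanSpace ℝ (Fin N)))]
      convolution ((φ i).normed volume) (K.indicator u) (ContinuousLinearMap.lsmul ℝ ℝ) volume)
    {v : MeasFun Ω} (hv : v ∈ EOrlicz (complementary A) Ω) :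
    Tendsto (fun i => ∫ x in (Ω : Set (EuclideanSpace ℝ (Fin N))), w i x * v x) l
      (𝓝 (∫ x in (Ω : Set (EuclideanSpace ℝ (Fin N))), u x * v x)) := by
  obtain ⟨hm, hint, c, hc, hfin⟩ := hA.exists_modular_indicator_lt_top hu hK hKΩ
  have h := hA.tendsto_integral_convolution_mul hm hint hc hfin v.stronglyMeasurable
    (boundedApprox_of_mem_EOrlicz hv) hφ
  have h1 : ∫ x in (Ω : Set (EuclideanSpace ℝ (Fin N))), u x * v x =
      ∫ x in (Ω : Set (EuclideanSpace ℝ (Fin N))), K.indicator u x * v x := by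
    refine setIntegral_congr_ae Ω.isOpen.measurableSet ?_
    filter_upwards [hu0] with x hx hxΩ
    by_cases hxK : x ∈ K
    · rw [indicator_of_mem hxK]
    · rw [indicator_of_notMem hxK, hx ⟨hxΩ, hxK⟩]
  rw [h1]
  refine h.congr fun i => integral_congr_ae ?_
  filter_upwards [hw i] with x hx
  rw [hx]

theorem tsupport_convolution_bump_subset {K : Set (EuclideanSpace ℝ (Fin N))} {δ : ℝ}
    (f : EuclideanSpace ℝ (Fin N) → ℝ) (φ : ContDiffBump (0 : EuclideanSpace ℝ (Fin N)))
    (hφ : φ.rOut ≤ δ) :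
    tsupport (convolution (φ.normed volume) (K.indicator f) (ContinuousLinearMap.lsmul ℝ ℝ)
      volume) ⊆ Metric.cthickening δ K := by
  refine (closure_mono ?_).trans (Metric.closure_thickening_subset_cthickening δ K)
  refine (support_convolution_subset _).trans ?_
  rintro _ ⟨a, ha, b, hb, rfl⟩
  rw [φ.support_normed_eq] at ha
  refine Metric.mem_thickening_iff.2 ⟨b, support_indicator_subset hb, ?_⟩
  have : dist a 0 < φ.rOut := ha
  simp only [dist_eq_norm, add_sub_cancel_right, sub_zero] at this ⊢
  linarith

/-- In an infimum of induced topologies, convergence is tested one functional at a time. -/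
theorem tendsto_weakStarW1_iff {ι : Type*} {l : Filter ι} {w : ι → W1Orlicz A Ω}
    {u : W1Orlicz A Ω} :
    Tendsto w l (@nhds _ (weakStarW1 A Ω) u) ↔
      ∀ v, Tendsto (fun i => pairing v (jet (w i))) l (𝓝 (pairing v (jet u))) := by
  rw [weakStarW1, @nhds_induced _ _ (weakStar A Ω), tendsto_comap_iff, weakStar, nhds_iInf,
    tendsto_iInf]
  refine forall_congr' fun v => ?_
  rw [nhds_induced, tendsto_comap_iff]
  rfl

theorem IsNFunction.mem_W10Orlicz (hA : IsNFunction A) (u : W1Orlicz A Ω)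
    (hK : IsCompact (essSupport Ω u.1))
    (hKΩ : essSupport Ω u.1 ⊆ (Ω : Set (EuclideanSpace ℝ (Fin N)))) : u ∈ W10Orlicz A Ω := by
  set K := essSupport Ω u.1
  have hu0 : ∀ᵐ x, x ∈ (Ω : Set (EuclideanSpace ℝ (Fin N))) \ K → u.1 x = 0 :=
    ae_eq_zero_of_notMem_essSupport u.1
  have hg0 : ∀ i, ∀ᵐ x, x ∈ (Ω : Set (EuclideanSpace ℝ (Fin N))) \ K →
      (weakPartial u i).1 x = 0 := fun i =>
    (weakPartial_spec u i).ae_eq_zero (Ω.isOpen.sdiff hK.isClosed) sdiff_subset hu0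
  obtain ⟨δ, hδ, hδΩ⟩ := hK.exists_cthickening_subset_open Ω.isOpen hKΩ
  have hpos : ∀ n : ℕ, 0 < δ / ((n : ℝ) + 1) := fun n => by positivity
  -- The outer radius δ / (n + 1) is at most δ from n = 0 on, so every mollification is supported in
  -- Ω.
  let φ : ℕ → ContDiffBump (0 : EuclideanSpace ℝ (Fin N)) := fun n =>
    ⟨δ / ((n : ℝ) + 1) / 2, δ / ((n : ℝ) + 1), half_pos (hpos n), half_lt_self (hpos n)⟩
  have hφ : Tendsto (fun n => (φ n).rOut) atTop (𝓝 0) := by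
    have := (tendsto_one_div_add_atTop_nhds_zero_nat (𝕜 := ℝ)).const_mul δ
    simpa only [mul_one_div, mul_zero] using this
  have hφδ : ∀ n, (φ n).rOut ≤ δ := fun n =>
    div_le_self hδ.le (by linarith [(Nat.cast_nonneg n : (0 : ℝ) ≤ n)])
  have hint : LocallyIntegrable (K.indicator u.1) :=
    (hA.exists_modular_indicator_lt_top u.2.1 hK hKΩ).2.1.locallyIntegrable
  have hsub := fun n => tsupport_convolution_bump_subset (K := K) u.1 (φ n) (hφδ n)
  let Φ : ℕ → 𝓓(Ω, ℝ) := fun n =>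
    ⟨convolution ((φ n).normed volume) (K.indicator u.1) (ContinuousLinearMap.lsmul ℝ ℝ) volume,
      (φ n).hasCompactSupport_normed.contDiff_convolution_left _ (φ n).contDiff_normed hint,
      hK.cthickening.of_isClosed_subset (isClosed_tsupport _) (hsub n),
      (hsub n).trans hδΩ⟩
  have hΦ : ∀ n i, partialDeriv i (Φ n) = convolution ((φ n).normed volume)
      (K.indicator (weakPartial u i).1) (ContinuousLinearMap.lsmul ℝ ℝ) volume := fun n i =>
    funext fun x => partialDeriv_convolution hint
      (fun ψ hψ => (weakPartial_spec u i).integral_indicator hK hKΩ hu0 (hg0 i) hψ)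
      (φ n).contDiff_normed (φ n).hasCompactSupport_normed x
  refine @mem_closure_of_tendsto _ (weakStarW1 A Ω) _ _ _ (fun n => hA.ofTestFunction (Φ n)) atTop _
    (tendsto_weakStarW1_iff.2 fun v => ?_)
    (.of_forall fun n => ⟨Φ n, hA.coe_ofTestFunction (Φ n)⟩)
  refine Tendsto.add ?_ (tendsto_finsetSum _ fun i _ => ?_)
  · exact hA.tendsto_pairing_of_ae_eq_convolution u.2.1 hK hKΩ hu0 hφ
      (fun n => hA.coe_ofTestFunction (Φ n)) v.1.2
  · refine hA.tendsto_pairing_of_ae_eq_convolution (weakPartial u i).2 hK hKΩ (hg0 i) hφ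
      (fun n => ?_) (v.2 i).2
    rw [← hΦ n i]
    exact hA.weakPartial_ofTestFunction (Φ n) i

end Approximation

end OrliczSobolev

theorem mainTheorem9 (N : ℕ) (Ω : TopologicalSpace.Opens (EuclideanSpace ℝ (Fin N)))
    (hΩ : OrliczSobolev.SegmentProperty (Ω : Set (EuclideanSpace ℝ (Fin N))))
    (A : ℝ → ℝ) (hA : OrliczSobolev.IsNFunction A)
    (u : OrliczSobolev.W1Orlicz A Ω)
    (hcompact : IsCompact (OrliczSobolev.essSupport Ω u.1))
    (hsub : OrliczSobolev.essSupport Ω u.1 ⊆ (Ω : Set (EuclideanSpace ℝ (Fin N)))) :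
    u ∈ OrliczSobolev.W10Orlicz A Ω :=
  hA.mem_W10Orlicz u hcompact hsub
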